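/- **Lemma.** Let $(-)^*$ be the free strict $\omega$-category monad on the category $\mathbf{GSet}$ of globular sets, with unit $\eta$ and multiplication $\mu$, and let $\mathbf 1$ be the terminal globular set. A *globular operad* $G$ is a monoid in the category $\mathbf{GSet}/\mathbf 1^*$ with the tensor product $X\circ Y = X^*\times_{\mathbf 1^*}Y$ (formed from $!^*:X^*\to\mathbf 1^*$ and $Y\to\mathbf 1^*$, with structure map $X\circ Y\to X^*\to\mathbf 1^{**}\xrightarrow{\mu_{\mathbf 1}}\mathbf 1^*$) and unit $\eta_{\mathbf 1}:\mathbf 1\to\mathbf 1^*$; a morphism of globular operads is a morphism of such monoids. A globular operad $G$, with structure map $g:G\to\mathbf 1^*$, induces a monad on $\mathbf{GSet}$ sending $A$ to the pullback $A_G = A^*\times_{\mathbf 1^*}G$ of $!^*:A^*\to\mathbf 1^*$ and $g$, whose unit and multiplication are induced by those of $(-)^*$ and by the identities and composition of $G$; the category $G\text{-}\mathbf{Alg}$ of $G$-algebras is the category of algebras for this monad. Let $f:G\to H$ be a morphism of globular operads. For a globular set $A$ let $A_f:A_G\to A_H$ be the unique morphism whose composite with the projection $A_H\to A^*$ is the projection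 $A_G\to A^*$, and whose composite with the projection $A_H\to H$ is $A_G\to G\xrightarrow{f}H$. Then for every $H$-algebra $(A,\theta)$ the pair $(A,\theta\cdot A_f)$ is a $G$-algebra, and there is a faithful functor $H\text{-}\mathbf{Alg}\to G\text{-}\mathbf{Alg}$ which sends each $H$-algebra $(A,\theta)$ to $(A,\theta\cdot A_f)$ and which sends each morphism of $H$-algebras to the same underlying morphism of globular sets. -/

import Mathlib

open CategoryTheory

universe u

/-! ## Globular sets -/

/-- A globular set: sets of `n`-cells with source and target maps satisfying
`ss = st` and `ts = tt`. -/
structure GSet : Type (u + 1) where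
  cells : ℕ → Type u
  src : ∀ n, cells (n + 1) → cells n
  tgt : ∀ n, cells (n + 1) → cells n
  src_src : ∀ n (x : cells (n + 2)), src n (src (n + 1) x) = src n (tgt (n + 1) x)
  tgt_src : ∀ n (x : cells (n + 2)), tgt n (src (n + 1) x) = tgt n (tgt (n + 1) x)

namespace GSet

/-- A morphism of globular sets. -/
@[ext]
structure Hom (A B : GSet.{u}) : Type u where
  app : ∀ n, A.cells n → B.cells n
  app_src : ∀ n (x : A.cells (n + 1)), app n (A.src n x) = B.src n (app (n + 1) x)
  app_tgt : ∀ n (x : A.cells (n + 1)), app n (A.tgt n x) = B.tgt n (app (n + 1) x)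

instance : Category GSet.{u} where
  Hom := Hom
  id A := ⟨fun _ x => x, fun _ _ => rfl, fun _ _ => rfl⟩
  comp f g := ⟨fun n x => g.app n (f.app n x),
    fun n x => by rw [f.app_src, g.app_src], fun n x => by rw [f.app_tgt, g.app_tgt]⟩

/-- The action of a morphism of globular sets on `n`-cells. -/
def Hom.on {A B : GSet.{u}} (f : A ⟶ B) (n : ℕ) (x : A.cells n) : B.cells n := Hom.app f n x

theorem hom_ext {A B : GSet.{u}} {f g : A ⟶ B} (h : ∀ n x, Hom.on f n x = Hom.on g n x) :
    f = g :=
  Hom.ext (funext fun n => funext fun x => h n x)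

theorem on_src {A B : GSet.{u}} (f : A ⟶ B) (n : ℕ) (x : A.cells (n + 1)) :
    Hom.on f n (A.src n x) = B.src n (Hom.on f (n + 1) x) := Hom.app_src f n x

theorem on_tgt {A B : GSet.{u}} (f : A ⟶ B) (n : ℕ) (x : A.cells (n + 1)) :
    Hom.on f n (A.tgt n x) = B.tgt n (Hom.on f (n + 1) x) := Hom.app_tgt f n x

@[simp] theorem on_id (A : GSet.{u}) (n : ℕ) (x : A.cells n) : Hom.on (𝟙 A) n x = x := rfl

@[simp] theorem on_comp {A B C : GSet.{u}} (f : A ⟶ B) (g : B ⟶ C) (n : ℕ) (x : A.cells n) :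
    Hom.on (f ≫ g) n x = Hom.on g n (Hom.on f n x) := rfl

/-- The terminal globular set, with exactly one cell in each dimension. -/
def one : GSet.{u} where
  cells _ := PUnit
  src _ x := x
  tgt _ x := x
  src_src _ _ := rfl
  tgt_src _ _ := rfl

/-- The unique morphism to the terminal globular set. -/
def bang (A : GSet.{u}) : A ⟶ one.{u} :=
  Hom.mk (fun _ _ => PUnit.unit) (fun _ _ => rfl) (fun _ _ => rfl)

theorem to_one_ext {A : GSet.{u}} (f g : A ⟶ one.{u}) : f = g := hom_ext fun _ _ => rfl

/-- The pullback of globular sets: its `n`-cells are the pairs of `n`-cells with equal images. -/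
def pb {A B C : GSet.{u}} (f : A ⟶ C) (g : B ⟶ C) : GSet.{u} where
  cells n := {p : A.cells n × B.cells n // Hom.on f n p.1 = Hom.on g n p.2}
  src n p := ⟨(A.src n p.1.1, B.src n p.1.2), by rw [on_src, on_src, p.2]⟩
  tgt n p := ⟨(A.tgt n p.1.1, B.tgt n p.1.2), by rw [on_tgt, on_tgt, p.2]⟩
  src_src n p := Subtype.ext (Prod.ext (A.src_src n _) (B.src_src n _))
  tgt_src n p := Subtype.ext (Prod.ext (A.tgt_src n _) (B.tgt_src n _))

section pb

variable {A B C : GSet.{u}} {f : A ⟶ C} {g : B ⟶ C}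

/-- The first projection of a pullback. -/
def fst (f : A ⟶ C) (g : B ⟶ C) : pb f g ⟶ A :=
  Hom.mk (fun _ p => p.1.1) (fun _ _ => rfl) (fun _ _ => rfl)

/-- The second projection of a pullback. -/
def snd (f : A ⟶ C) (g : B ⟶ C) : pb f g ⟶ B :=
  Hom.mk (fun _ p => p.1.2) (fun _ _ => rfl) (fun _ _ => rfl)

theorem pb_condition (f : A ⟶ C) (g : B ⟶ C) : fst f g ≫ f = snd f g ≫ g :=
  hom_ext fun _ p => p.2

/-- The morphism to a pullback given by its universal property. -/
def lift {X : GSet.{u}} (a : X ⟶ A) (b : X ⟶ B) (h : a ≫ f = b ≫ g) : X ⟶ pb f g :=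
  Hom.mk
    (fun n x => ⟨(Hom.on a n x, Hom.on b n x), congrArg (fun e => Hom.on e n x) h⟩)
    (fun n x => Subtype.ext (Prod.ext (on_src a n x) (on_src b n x)))
    (fun n x => Subtype.ext (Prod.ext (on_tgt a n x) (on_tgt b n x)))

@[simp]
theorem lift_fst {X : GSet.{u}} (a : X ⟶ A) (b : X ⟶ B) (h : a ≫ f = b ≫ g) :
    lift a b h ≫ fst f g = a := rfl

@[simp]
theorem lift_snd {X : GSet.{u}} (a : X ⟶ A) (b : X ⟶ B) (h : a ≫ f = b ≫ g) :
    lift a b h ≫ snd f g = b := rfl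

theorem pb_condition_assoc (f : A ⟶ C) (g : B ⟶ C) {X : GSet.{u}} (k : C ⟶ X) :
    fst f g ≫ f ≫ k = snd f g ≫ g ≫ k := by
  rw [← Category.assoc, pb_condition, Category.assoc]

@[simp]
theorem lift_fst_assoc {X Y : GSet.{u}} (a : X ⟶ A) (b : X ⟶ B) (h : a ≫ f = b ≫ g)
    (k : A ⟶ Y) : lift a b h ≫ fst f g ≫ k = a ≫ k := rfl

@[simp]
theorem lift_snd_assoc {X Y : GSet.{u}} (a : X ⟶ A) (b : X ⟶ B) (h : a ≫ f = b ≫ g)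
    (k : B ⟶ Y) : lift a b h ≫ snd f g ≫ k = b ≫ k := rfl

theorem pb_hom_ext {X : GSet.{u}} {p q : X ⟶ pb f g} (h₁ : p ≫ fst f g = q ≫ fst f g)
    (h₂ : p ≫ snd f g = q ≫ snd f g) : p = q :=
  hom_ext fun n x => Subtype.ext (Prod.ext (congrArg (fun e => Hom.on e n x) h₁)
    (congrArg (fun e => Hom.on e n x) h₂))

theorem pb_isPullback (f : A ⟶ C) (g : B ⟶ C) : IsPullback (fst f g) (snd f g) f g :=
  ⟨⟨pb_condition f g⟩, ⟨Limits.PullbackCone.IsLimit.mk _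
    (fun s => lift s.fst s.snd s.condition) (fun _ => rfl) (fun _ => rfl)
    (fun _ _ h₁ h₂ => pb_hom_ext h₁ h₂)⟩⟩

end pb

end GSet

/-! ## Strict `ω`-categories -/

/-- Iterating maps `C (n + 1) → C n` downwards from dimension `n` to dimension `k`. -/
def iterDown {C : ℕ → Type u} (f : ∀ n, C (n + 1) → C n) {k n : ℕ} (h : k ≤ n) : C n → C k :=
  Nat.leRec (motive := fun n _ => C n → C k) id (fun n _ r x => r (f n x)) h

/-- Iterating maps `C n → C (n + 1)` upwards from dimension `k` to dimension `n`. -/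
def iterUp {C : ℕ → Type u} (f : ∀ n, C n → C (n + 1)) {k n : ℕ} (h : k ≤ n) : C k → C n :=
  Nat.leRec (motive := fun n _ => C k → C n) id (fun n _ r x => f n (r x)) h

theorem iterDown_self {C : ℕ → Type u} (f : ∀ n, C (n + 1) → C n) {k : ℕ} (h : k ≤ k) (x : C k) :
    iterDown f h x = x := by
  simp [iterDown, Nat.leRec_self]

theorem iterDown_succ {C : ℕ → Type u} (f : ∀ n, C (n + 1) → C n) {k n : ℕ} (h : k ≤ n)
    (h' : k ≤ n + 1) (x : C (n + 1)) : iterDown f h' x = iterDown f h (f n x) := by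
  simp [iterDown, Nat.leRec_succ _ _ h]

theorem iterUp_self {C : ℕ → Type u} (f : ∀ n, C n → C (n + 1)) {k : ℕ} (h : k ≤ k) (x : C k) :
    iterUp f h x = x := by
  simp [iterUp, Nat.leRec_self]

theorem iterUp_succ {C : ℕ → Type u} (f : ∀ n, C n → C (n + 1)) {k n : ℕ} (h : k ≤ n)
    (h' : k ≤ n + 1) (x : C k) : iterUp f h' x = f n (iterUp f h x) := by
  simp [iterUp, Nat.leRec_succ _ _ h]

/-- A strict `ω`-category: a globular set with an identity `(n + 1)`-cell on every `n`-cell and,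
for `k < n`, a composite of every pair of `n`-cells `x`, `y` such that the `k`-dimensional target of
`x` is the `k`-dimensional source of `y`, subject to the usual axioms. In each axiom the cells
that are composed are assumed composable; the composability of the composite cells on either side
is a consequence of the axioms on sources and targets. -/
structure StrOmegaCat : Type (u + 1) extends GSet.{u} where
  ident : ∀ n, cells n → cells (n + 1)
  comp : ∀ {n : ℕ} (k : ℕ) (h : k < n) (x y : cells n),
    iterDown tgt h.le x = iterDown src h.le y → cells n
  src_ident : ∀ n (x : cells n), src n (ident n x) = x
  tgt_ident : ∀ n (x : cells n), tgt n (ident n x) = x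
  src_comp_self : ∀ n (x y : cells (n + 1)) hxy,
    src n (comp n (Nat.lt_succ_self n) x y hxy) = src n x
  tgt_comp_self : ∀ n (x y : cells (n + 1)) hxy,
    tgt n (comp n (Nat.lt_succ_self n) x y hxy) = tgt n y
  src_comp : ∀ n k (h : k < n) (x y : cells (n + 1)) hxy hxy',
    src n (comp k (Nat.lt_succ_of_lt h) x y hxy) = comp k h (src n x) (src n y) hxy'
  tgt_comp : ∀ n k (h : k < n) (x y : cells (n + 1)) hxy hxy',
    tgt n (comp k (Nat.lt_succ_of_lt h) x y hxy) = comp k h (tgt n x) (tgt n y) hxy'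
  comp_assoc : ∀ n k (h : k < n) (x y z : cells n) hxy hyz hl hr,
    comp k h (comp k h x y hxy) z hl = comp k h x (comp k h y z hyz) hr
  ident_comp : ∀ n k (h : k < n) (x : cells n) hx,
    comp k h (iterUp ident h.le (iterDown src h.le x)) x hx = x
  comp_ident : ∀ n k (h : k < n) (x : cells n) hx,
    comp k h x (iterUp ident h.le (iterDown tgt h.le x)) hx = x
  interchange : ∀ n p q (hpq : p < q) (hq : q < n) (w x y z : cells n) hwx hyz hl hwy hxz hr,
    comp p (hpq.trans hq) (comp q hq w x hwx) (comp q hq y z hyz) hl =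
      comp q hq (comp p (hpq.trans hq) w y hwy) (comp p (hpq.trans hq) x z hxz) hr
  ident_comp_ident : ∀ n k (h : k < n) (x y : cells n) hxy hxy',
    comp k (Nat.lt_succ_of_lt h) (ident n x) (ident n y) hxy' = ident n (comp k h x y hxy)

theorem GSet.Hom.on_iterDown_src {A B : GSet.{u}} (f : A ⟶ B) {k n : ℕ} (h : k ≤ n)
    (x : A.cells n) : Hom.on f k (iterDown A.src h x) = iterDown B.src h (Hom.on f n x) := by
  induction h with
  | refl => simp only [iterDown_self]
  | step h ih => rw [iterDown_succ _ h, iterDown_succ _ h, ih, GSet.on_src]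

theorem GSet.Hom.on_iterDown_tgt {A B : GSet.{u}} (f : A ⟶ B) {k n : ℕ} (h : k ≤ n)
    (x : A.cells n) : Hom.on f k (iterDown A.tgt h x) = iterDown B.tgt h (Hom.on f n x) := by
  induction h with
  | refl => simp only [iterDown_self]
  | step h ih => rw [iterDown_succ _ h, iterDown_succ _ h, ih, GSet.on_tgt]

namespace StrOmegaCat

theorem composable_map {C D : StrOmegaCat.{u}} (f : C.toGSet ⟶ D.toGSet) {n k : ℕ} (h : k ≤ n)
    {x y : C.cells n} (hxy : iterDown C.tgt h x = iterDown C.src h y) :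
    iterDown D.tgt h (GSet.Hom.on f n x) = iterDown D.src h (GSet.Hom.on f n y) := by
  rw [← GSet.Hom.on_iterDown_tgt, ← GSet.Hom.on_iterDown_src, hxy]

/-- A strict `ω`-functor: a morphism of globular sets that preserves identities and composites. -/
@[ext]
structure Hom (C D : StrOmegaCat.{u}) : Type u where
  hom : C.toGSet ⟶ D.toGSet
  map_ident : ∀ n (x : C.cells n),
    GSet.Hom.on hom (n + 1) (C.ident n x) = D.ident n (GSet.Hom.on hom n x)
  map_comp : ∀ n k (h : k < n) (x y : C.cells n) hxy,
    GSet.Hom.on hom n (C.comp k h x y hxy) =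
      D.comp k h (GSet.Hom.on hom n x) (GSet.Hom.on hom n y) (composable_map hom h.le hxy)

instance : Category StrOmegaCat.{u} where
  Hom := Hom
  id C := ⟨𝟙 C.toGSet, fun _ _ => rfl, fun _ _ _ _ _ _ => rfl⟩
  comp f g := ⟨f.hom ≫ g.hom,
    fun n x => by simp only [GSet.on_comp, f.map_ident, g.map_ident],
    fun n k h x y hxy => by simp only [GSet.on_comp, f.map_comp, g.map_comp]⟩

/-- The forgetful functor from strict `ω`-categories to globular sets. -/
def forget : StrOmegaCat.{u} ⥤ GSet.{u} where
  obj C := C.toGSet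
  map f := Hom.hom f
  map_id _ := rfl
  map_comp _ _ := rfl

end StrOmegaCat

/-! ## The free strict `ω`-category on a globular set -/

namespace FreeOmega

/-- Formal expressions in the cells of `A`, identities and composition symbols. -/
inductive Raw (A : GSet.{u}) : ℕ → Type u
  | of {n : ℕ} (a : A.cells n) : Raw A n
  | ident {n : ℕ} (x : Raw A n) : Raw A (n + 1)
  | comp {n : ℕ} (k : ℕ) (h : k < n) (x y : Raw A n) : Raw A n

variable {A : GSet.{u}}

/-- Expressions one dimension below `n`. -/
def Pred (A : GSet.{u}) : ℕ → Type u
  | 0 => PUnit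
  | n + 1 => Raw A n

/-- The formal source of an expression, without content in dimension `0`. -/
def Raw.srcAux : ∀ {n : ℕ}, Raw A n → Pred A n
  | 0, _ => PUnit.unit
  | n + 1, .of a => Raw.of (A.src n a)
  | _ + 1, .ident x => x
  | n + 1, .comp k _ x y =>
    if hk : k < n then Raw.comp k hk (Raw.srcAux x) (Raw.srcAux y) else Raw.srcAux x

/-- The formal target of an expression, without content in dimension `0`. -/
def Raw.tgtAux : ∀ {n : ℕ}, Raw A n → Pred A n
  | 0, _ => PUnit.unit
  | n + 1, .of a => Raw.of (A.tgt n a)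
  | _ + 1, .ident x => x
  | n + 1, .comp k _ x y =>
    if hk : k < n then Raw.comp k hk (Raw.tgtAux x) (Raw.tgtAux y) else Raw.tgtAux y

/-- The formal source of an expression. -/
def Raw.src (n : ℕ) (x : Raw A (n + 1)) : Raw A n := Raw.srcAux x

/-- The formal target of an expression. -/
def Raw.tgt (n : ℕ) (x : Raw A (n + 1)) : Raw A n := Raw.tgtAux x

theorem Raw.src_comp {n k : ℕ} (h : k < n + 1) (x y : Raw A (n + 1)) :
    Raw.src n (.comp k h x y) =
      if hk : k < n then .comp k hk (Raw.src n x) (Raw.src n y) else Raw.src n x := rfl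

theorem Raw.tgt_comp {n k : ℕ} (h : k < n + 1) (x y : Raw A (n + 1)) :
    Raw.tgt n (.comp k h x y) =
      if hk : k < n then .comp k hk (Raw.tgt n x) (Raw.tgt n y) else Raw.tgt n y := rfl

/-- The identity symbols, with explicit dimension. -/
def Raw.idn (n : ℕ) (x : Raw A n) : Raw A (n + 1) := .ident x

/-- The partial equivalence relation of provable equality of well-formed expressions:
`Eqv x x` says that `x` is well-formed. -/
inductive Eqv : ∀ {n : ℕ}, Raw A n → Raw A n → Prop
  | of {n : ℕ} (a : A.cells n) : Eqv (.of a) (.of a)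
  | symm {n : ℕ} {x y : Raw A n} : Eqv x y → Eqv y x
  | trans {n : ℕ} {x y z : Raw A n} : Eqv x y → Eqv y z → Eqv x z
  | ident {n : ℕ} {x y : Raw A n} : Eqv x y → Eqv (.ident x) (.ident y)
  | comp {n k : ℕ} (h : k < n) {x x' y y' : Raw A n} : Eqv x x' → Eqv y y' →
      Eqv (iterDown Raw.tgt h.le x) (iterDown Raw.src h.le y) →
      Eqv (.comp k h x y) (.comp k h x' y')
  | src {n : ℕ} {x y : Raw A (n + 1)} : Eqv x y → Eqv (Raw.src n x) (Raw.src n y)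
  | tgt {n : ℕ} {x y : Raw A (n + 1)} : Eqv x y → Eqv (Raw.tgt n x) (Raw.tgt n y)
  | src_src {n : ℕ} {x : Raw A (n + 2)} : Eqv x x →
      Eqv (Raw.src n (Raw.src (n + 1) x)) (Raw.src n (Raw.tgt (n + 1) x))
  | tgt_src {n : ℕ} {x : Raw A (n + 2)} : Eqv x x →
      Eqv (Raw.tgt n (Raw.src (n + 1) x)) (Raw.tgt n (Raw.tgt (n + 1) x))
  | assoc {n k : ℕ} (h : k < n) {x y z : Raw A n} :
      Eqv (.comp k h (.comp k h x y) z) (.comp k h (.comp k h x y) z) →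
      Eqv (.comp k h x (.comp k h y z)) (.comp k h x (.comp k h y z)) →
      Eqv (.comp k h (.comp k h x y) z) (.comp k h x (.comp k h y z))
  | ident_comp {n k : ℕ} (h : k < n) {x : Raw A n} :
      Eqv (.comp k h (iterUp Raw.idn h.le (iterDown Raw.src h.le x)) x)
        (.comp k h (iterUp Raw.idn h.le (iterDown Raw.src h.le x)) x) →
      Eqv (.comp k h (iterUp Raw.idn h.le (iterDown Raw.src h.le x)) x) x
  | comp_ident {n k : ℕ} (h : k < n) {x : Raw A n} :
      Eqv (.comp k h x (iterUp Raw.idn h.le (iterDown Raw.tgt h.le x)))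
        (.comp k h x (iterUp Raw.idn h.le (iterDown Raw.tgt h.le x))) →
      Eqv (.comp k h x (iterUp Raw.idn h.le (iterDown Raw.tgt h.le x))) x
  | interchange {n p q : ℕ} (hp : p < n) (hq : q < n) (hpq : p < q) {w x y z : Raw A n} :
      Eqv (.comp p hp (.comp q hq w x) (.comp q hq y z))
        (.comp p hp (.comp q hq w x) (.comp q hq y z)) →
      Eqv (.comp q hq (.comp p hp w y) (.comp p hp x z))
        (.comp q hq (.comp p hp w y) (.comp p hp x z)) →
      Eqv (.comp p hp (.comp q hq w x) (.comp q hq y z))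
        (.comp q hq (.comp p hp w y) (.comp p hp x z))
  | ident_comp_ident {n k : ℕ} (h : k < n) (h' : k < n + 1) {x y : Raw A n} :
      Eqv (.comp k h' (.ident x) (.ident y)) (.comp k h' (.ident x) (.ident y)) →
      Eqv (.ident (.comp k h x y)) (.ident (.comp k h x y)) →
      Eqv (.comp k h' (.ident x) (.ident y)) (.ident (.comp k h x y))

/-- Well-formed expressions up to provable equality. -/
def setoid (A : GSet.{u}) (n : ℕ) : Setoid {x : Raw A n // Eqv x x} where
  r x y := Eqv x.1 y.1
  iseqv := ⟨fun x => x.2, fun h => h.symm, fun h h' => h.trans h'⟩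

/-- The `n`-cells of the free strict `ω`-category. -/
def Cell (A : GSet.{u}) (n : ℕ) : Type u := Quotient (setoid A n)

/-- The class of a well-formed expression. -/
def mk {n : ℕ} (x : Raw A n) (hx : Eqv x x) : Cell A n := Quotient.mk (setoid A n) ⟨x, hx⟩

theorem mk_eq_iff {n : ℕ} {x y : Raw A n} (hx : Eqv x x) (hy : Eqv y y) :
    mk x hx = mk y hy ↔ Eqv x y :=
  ⟨fun h => Quotient.exact (s := setoid A n) h, fun h => Quotient.sound (s := setoid A n) h⟩

theorem exists_rep {n : ℕ} (c : Cell A n) : ∃ x hx, c = mk (A := A) x hx := by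
  obtain ⟨⟨x, hx⟩, rfl⟩ := Quotient.exists_rep (s := setoid A n) c
  exact ⟨x, hx, rfl⟩

/-- The source map on cells. -/
def src (n : ℕ) : Cell A (n + 1) → Cell A n :=
  Quotient.map (fun x => ⟨Raw.src n x.1, x.2.src⟩) fun _ _ h => Eqv.src h

/-- The target map on cells. -/
def tgt (n : ℕ) : Cell A (n + 1) → Cell A n :=
  Quotient.map (fun x => ⟨Raw.tgt n x.1, x.2.tgt⟩) fun _ _ h => Eqv.tgt h

/-- Identity cells. -/
def ident (n : ℕ) : Cell A n → Cell A (n + 1) :=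
  Quotient.map (fun x => ⟨.ident x.1, x.2.ident⟩) fun _ _ h => Eqv.ident h

theorem src_mk {n : ℕ} (x : Raw A (n + 1)) (hx) : src n (mk x hx) = mk (Raw.src n x) hx.src := rfl
theorem tgt_mk {n : ℕ} (x : Raw A (n + 1)) (hx) : tgt n (mk x hx) = mk (Raw.tgt n x) hx.tgt := rfl
theorem ident_mk {n : ℕ} (x : Raw A n) (hx) : ident n (mk x hx) = mk (.ident x) hx.ident := rfl

theorem iterDown_src_mk {n k : ℕ} (h : k ≤ n) (x : Raw A n) (hx : Eqv x x) :
    ∃ h', iterDown src h (mk x hx) = mk (iterDown Raw.src h x) h' := by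
  induction h with
  | refl => simp only [iterDown_self]; exact ⟨hx, trivial⟩
  | step h ih => simp only [iterDown_succ _ h, src_mk]; exact ih _ _

theorem iterDown_tgt_mk {n k : ℕ} (h : k ≤ n) (x : Raw A n) (hx : Eqv x x) :
    ∃ h', iterDown tgt h (mk x hx) = mk (iterDown Raw.tgt h x) h' := by
  induction h with
  | refl => simp only [iterDown_self]; exact ⟨hx, trivial⟩
  | step h ih => simp only [iterDown_succ _ h, tgt_mk]; exact ih _ _

theorem iterUp_mk {n k : ℕ} (h : k ≤ n) (x : Raw A k) (hx : Eqv x x) :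
    ∃ h', iterUp ident h (mk x hx) = mk (iterUp Raw.idn h x) h' := by
  induction h with
  | refl => simp only [iterUp_self]; exact ⟨hx, trivial⟩
  | step h ih =>
    obtain ⟨h', e⟩ := ih
    simp only [iterUp_succ _ h, e, ident_mk]
    exact ⟨h'.ident, rfl⟩

theorem composable_iff {n k : ℕ} (h : k ≤ n) {x y : Raw A n} (hx : Eqv x x) (hy : Eqv y y) :
    iterDown tgt h (mk x hx) = iterDown src h (mk y hy) ↔
      Eqv (iterDown Raw.tgt h x) (iterDown Raw.src h y) := by
  obtain ⟨h₁, e₁⟩ := iterDown_tgt_mk h x hx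
  obtain ⟨h₂, e₂⟩ := iterDown_src_mk h y hy
  rw [e₁, e₂, mk_eq_iff]

/-- Composition of cells, computed on representatives. -/
noncomputable def comp {n : ℕ} (k : ℕ) (h : k < n) (x y : Cell A n)
    (hxy : iterDown tgt h.le x = iterDown src h.le y) : Cell A n :=
  mk (.comp k h (Quotient.out x).1 (Quotient.out y).1)
    (.comp h (Quotient.out x).2 (Quotient.out y).2
      ((composable_iff h.le (Quotient.out x).2 (Quotient.out y).2).1
        ((congrArg _ (Quotient.out_eq x)).trans
          (hxy.trans (congrArg _ (Quotient.out_eq y).symm)))))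

theorem comp_mk {n k : ℕ} (h : k < n) (x y : Raw A n) (hx hy)
    (hxy : iterDown tgt h.le (mk x hx) = iterDown src h.le (mk y hy)) :
    comp k h (mk x hx) (mk y hy) hxy =
      mk (.comp k h x y) (.comp h hx hy ((composable_iff h.le hx hy).1 hxy)) := by
  have key : ∀ (z : Raw A n) (hz : Eqv z z), Eqv z (Quotient.out (mk z hz)).1 := fun z hz =>
    (mk_eq_iff hz (Quotient.out (mk z hz)).2).1 (Quotient.out_eq (mk z hz)).symm
  exact (mk_eq_iff _ _).2
    (.symm (.comp h (key x hx) (key y hy) ((composable_iff h.le hx hy).1 hxy)))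

/-- The free strict `ω`-category on a globular set. -/
noncomputable def free (A : GSet.{u}) : StrOmegaCat.{u} where
  cells := Cell A
  src := src
  tgt := tgt
  ident := ident
  comp := comp
  src_src n x := by
    obtain ⟨x, hx, rfl⟩ := exists_rep x
    exact (mk_eq_iff _ _).2 hx.src_src
  tgt_src n x := by
    obtain ⟨x, hx, rfl⟩ := exists_rep x
    exact (mk_eq_iff _ _).2 hx.tgt_src
  src_ident n x := by obtain ⟨x, hx, rfl⟩ := exists_rep x; rfl
  tgt_ident n x := by obtain ⟨x, hx, rfl⟩ := exists_rep x; rfl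
  src_comp_self n x y hxy := by
    obtain ⟨x, hx, rfl⟩ := exists_rep x
    obtain ⟨y, hy, rfl⟩ := exists_rep y
    rw [comp_mk]
    simp [src_mk, Raw.src_comp]
  tgt_comp_self n x y hxy := by
    obtain ⟨x, hx, rfl⟩ := exists_rep x
    obtain ⟨y, hy, rfl⟩ := exists_rep y
    rw [comp_mk]
    simp [tgt_mk, Raw.tgt_comp]
  src_comp n k h x y hxy hxy' := by
    obtain ⟨x, hx, rfl⟩ := exists_rep x
    obtain ⟨y, hy, rfl⟩ := exists_rep y
    simp only [src_mk, comp_mk, Raw.src_comp, h, dif_pos]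
  tgt_comp n k h x y hxy hxy' := by
    obtain ⟨x, hx, rfl⟩ := exists_rep x
    obtain ⟨y, hy, rfl⟩ := exists_rep y
    simp only [tgt_mk, comp_mk, Raw.tgt_comp, h, dif_pos]
  comp_assoc n k h x y z hxy hyz hl hr := by
    obtain ⟨x, hx, rfl⟩ := exists_rep x
    obtain ⟨y, hy, rfl⟩ := exists_rep y
    obtain ⟨z, hz, rfl⟩ := exists_rep z
    simp only [comp_mk] at hl hr ⊢
    exact (mk_eq_iff _ _).2 (.assoc h
      (.comp h (.comp h hx hy ((composable_iff _ hx hy).1 hxy)) hz ((composable_iff _ _ hz).1 hl))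
      (.comp h hx (.comp h hy hz ((composable_iff _ hy hz).1 hyz)) ((composable_iff _ hx _).1 hr)))
  ident_comp n k h x hx' := by
    obtain ⟨x, hx, rfl⟩ := exists_rep x
    obtain ⟨h₁, e₁⟩ := iterDown_src_mk h.le x hx
    obtain ⟨h₂, e₂⟩ := iterUp_mk h.le _ h₁
    have e₃ := (congrArg _ e₁).trans e₂
    revert hx'
    rw [e₃]
    intro hx'
    rw [comp_mk]
    exact (mk_eq_iff _ _).2 (.ident_comp h (.comp h h₂ hx ((composable_iff _ _ _).1 hx')))
  comp_ident n k h x hx' := by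
    obtain ⟨x, hx, rfl⟩ := exists_rep x
    obtain ⟨h₁, e₁⟩ := iterDown_tgt_mk h.le x hx
    obtain ⟨h₂, e₂⟩ := iterUp_mk h.le _ h₁
    have e₃ := (congrArg _ e₁).trans e₂
    revert hx'
    rw [e₃]
    intro hx'
    rw [comp_mk]
    exact (mk_eq_iff _ _).2 (.comp_ident h (.comp h hx h₂ ((composable_iff _ _ _).1 hx')))
  interchange n p q hpq hq w x y z hwx hyz hl hwy hxz hr := by
    obtain ⟨w, hw, rfl⟩ := exists_rep w
    obtain ⟨x, hx, rfl⟩ := exists_rep x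
    obtain ⟨y, hy, rfl⟩ := exists_rep y
    obtain ⟨z, hz, rfl⟩ := exists_rep z
    simp only [comp_mk] at hl hr ⊢
    exact (mk_eq_iff _ _).2 (.interchange (hpq.trans hq) hq hpq
      (.comp _ (.comp _ hw hx ((composable_iff _ hw hx).1 hwx))
        (.comp _ hy hz ((composable_iff _ hy hz).1 hyz)) ((composable_iff _ _ _).1 hl))
      (.comp _ (.comp _ hw hy ((composable_iff _ hw hy).1 hwy))
        (.comp _ hx hz ((composable_iff _ hx hz).1 hxz)) ((composable_iff _ _ _).1 hr)))
  ident_comp_ident n k h x y hxy hxy' := by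
    obtain ⟨x, hx, rfl⟩ := exists_rep x
    obtain ⟨y, hy, rfl⟩ := exists_rep y
    simp only [ident_mk, comp_mk] at hxy' ⊢
    exact (mk_eq_iff _ _).2 (.ident_comp_ident h (Nat.lt_succ_of_lt h)
      (.comp _ hx.ident hy.ident ((composable_iff _ _ _).1 hxy'))
      (.ident (.comp _ hx hy ((composable_iff _ _ _).1 hxy))))

/-- The inclusion of the generators. -/
def incl (A : GSet.{u}) : A ⟶ (free A).toGSet :=
  GSet.Hom.mk (fun _ a => mk (.of a) (.of a)) (fun _ _ => rfl) (fun _ _ => rfl)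

section eval

variable {C : StrOmegaCat.{u}}

/-- `Ev f x c` says that the expression `x` is defined under the interpretation `f` of the
generators in `C`, with value `c`. -/
def Ev (f : A ⟶ C.toGSet) : ∀ {n : ℕ}, Raw A n → C.cells n → Prop
  | n, .of a, c => c = GSet.Hom.on f n a
  | _, .ident (n := n) x, c => ∃ d, Ev f x d ∧ c = C.ident n d
  | _, .comp k h x y, c => ∃ a b hab, Ev f x a ∧ Ev f y b ∧ c = C.comp k h a b hab

theorem Ev.congr {f g : A ⟶ C.toGSet} (e : f = g) {n : ℕ} {x : Raw A n} {c : C.cells n}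
    (h : Ev f x c) : Ev g x c := e ▸ h

theorem Ev.unique {f : A ⟶ C.toGSet} {n : ℕ} {x : Raw A n} {c d : C.cells n}
    (hc : Ev f x c) (hd : Ev f x d) : c = d := by
  induction x with
  | of a => exact hc.trans hd.symm
  | ident x ih =>
    obtain ⟨c', hc', rfl⟩ := hc
    obtain ⟨d', hd', rfl⟩ := hd
    rw [ih hc' hd']
  | comp k h x y ihx ihy =>
    obtain ⟨a, b, hab, ha, hb, rfl⟩ := hc
    obtain ⟨a', b', hab', ha', hb', rfl⟩ := hd
    obtain rfl := ihx ha ha'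
    obtain rfl := ihy hb hb'
    rfl

theorem composable_src {k n : ℕ} (h : k < n) {a b : C.cells (n + 1)}
    (hab : iterDown C.tgt (Nat.lt_succ_of_lt h).le a = iterDown C.src (Nat.lt_succ_of_lt h).le b) :
    iterDown C.tgt h.le (C.src n a) = iterDown C.src h.le (C.src n b) := by
  obtain ⟨m, rfl⟩ : ∃ m, n = m + 1 := ⟨n - 1, by omega⟩
  have hk : k ≤ m := by omega
  simp only [iterDown_succ _ hk, iterDown_succ _ h.le] at hab ⊢
  rw [C.tgt_src, hab]

theorem composable_tgt {k n : ℕ} (h : k < n) {a b : C.cells (n + 1)}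
    (hab : iterDown C.tgt (Nat.lt_succ_of_lt h).le a = iterDown C.src (Nat.lt_succ_of_lt h).le b) :
    iterDown C.tgt h.le (C.tgt n a) = iterDown C.src h.le (C.tgt n b) := by
  obtain ⟨m, rfl⟩ : ∃ m, n = m + 1 := ⟨n - 1, by omega⟩
  have hk : k ≤ m := by omega
  simp only [iterDown_succ _ hk, iterDown_succ _ h.le] at hab ⊢
  rw [← C.src_src, hab]

theorem Ev.src {f : A ⟶ C.toGSet} : ∀ {n : ℕ} (x : Raw A (n + 1)) {c : C.cells (n + 1)},
    Ev f x c → Ev f (Raw.src n x) (C.src n c)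
  | n, .of a, c, hc => by
    obtain rfl : c = _ := hc
    exact (GSet.on_src f n a).symm
  | n, .ident x, c, hc => by
    obtain ⟨d, hd, rfl⟩ := hc
    rw [C.src_ident]; exact hd
  | n, .comp k h x y, c, hc => by
    obtain ⟨a, b, hab, ha, hb, rfl⟩ := hc
    have ihx := Ev.src x ha
    have ihy := Ev.src y hb
    by_cases hk : k < n
    · simp only [Raw.src_comp, hk, dif_pos]
      exact ⟨_, _, composable_src hk hab, ihx, ihy, C.src_comp n k hk a b _ _⟩
    · obtain rfl : k = n := by omega
      simp only [Raw.src_comp, hk, dif_neg, not_false_eq_true, C.src_comp_self]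
      exact ihx

theorem Ev.tgt {f : A ⟶ C.toGSet} : ∀ {n : ℕ} (x : Raw A (n + 1)) {c : C.cells (n + 1)},
    Ev f x c → Ev f (Raw.tgt n x) (C.tgt n c)
  | n, .of a, c, hc => by
    obtain rfl : c = _ := hc
    exact (GSet.on_tgt f n a).symm
  | n, .ident x, c, hc => by
    obtain ⟨d, hd, rfl⟩ := hc
    rw [C.tgt_ident]; exact hd
  | n, .comp k h x y, c, hc => by
    obtain ⟨a, b, hab, ha, hb, rfl⟩ := hc
    have ihx := Ev.tgt x ha
    have ihy := Ev.tgt y hb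
    by_cases hk : k < n
    · simp only [Raw.tgt_comp, hk, dif_pos]
      exact ⟨_, _, composable_tgt hk hab, ihx, ihy, C.tgt_comp n k hk a b _ _⟩
    · obtain rfl : k = n := by omega
      simp only [Raw.tgt_comp, hk, dif_neg, not_false_eq_true, C.tgt_comp_self]
      exact ihy

theorem Ev.iterDown_src {f : A ⟶ C.toGSet} {k n : ℕ} (h : k ≤ n) (x : Raw A n) {c : C.cells n}
    (hc : Ev f x c) : Ev f (iterDown Raw.src h x) (iterDown C.src h c) := by
  induction h with
  | refl => simpa only [iterDown_self] using hc
  | step h ih => simp only [iterDown_succ _ h]; exact ih _ (Ev.src x hc)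

theorem Ev.iterDown_tgt {f : A ⟶ C.toGSet} {k n : ℕ} (h : k ≤ n) (x : Raw A n) {c : C.cells n}
    (hc : Ev f x c) : Ev f (iterDown Raw.tgt h x) (iterDown C.tgt h c) := by
  induction h with
  | refl => simpa only [iterDown_self] using hc
  | step h ih => simp only [iterDown_succ _ h]; exact ih _ (Ev.tgt x hc)

theorem Ev.iterUp {f : A ⟶ C.toGSet} {k n : ℕ} (h : k ≤ n) (x : Raw A k) {c : C.cells k}
    (hc : Ev f x c) : Ev f (iterUp Raw.idn h x) (iterUp C.ident h c) := by
  induction h with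
  | refl => simpa only [iterUp_self] using hc
  | step h ih => simp only [iterUp_succ _ h]; exact ⟨_, ih, rfl⟩

theorem Eqv.ev (f : A ⟶ C.toGSet) {n : ℕ} {x y : Raw A n} (h : Eqv x y) :
    ∃ c, Ev f x c ∧ Ev f y c := by
  induction h with
  | of a => exact ⟨_, rfl, rfl⟩
  | symm _ ih => obtain ⟨c, h₁, h₂⟩ := ih; exact ⟨c, h₂, h₁⟩
  | trans _ _ ih ih' =>
    obtain ⟨c, h₁, h₂⟩ := ih
    obtain ⟨c', h₁', h₂'⟩ := ih'
    obtain rfl := h₂.unique h₁'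
    exact ⟨c, h₁, h₂'⟩
  | ident _ ih => obtain ⟨c, h₁, h₂⟩ := ih; exact ⟨_, ⟨c, h₁, rfl⟩, ⟨c, h₂, rfl⟩⟩
  | comp h _ _ _ ihx ihy ihc =>
    obtain ⟨a, h₁, h₂⟩ := ihx
    obtain ⟨b, h₃, h₄⟩ := ihy
    obtain ⟨c, h₅, h₆⟩ := ihc
    have hab := ((h₁.iterDown_tgt h.le).unique h₅).trans (h₆.unique (h₃.iterDown_src h.le))
    exact ⟨_, ⟨a, b, hab, h₁, h₃, rfl⟩, ⟨a, b, hab, h₂, h₄, rfl⟩⟩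
  | src _ ih => obtain ⟨c, h₁, h₂⟩ := ih; exact ⟨_, h₁.src, h₂.src⟩
  | tgt _ ih => obtain ⟨c, h₁, h₂⟩ := ih; exact ⟨_, h₁.tgt, h₂.tgt⟩
  | src_src _ ih =>
    obtain ⟨c, h₁, _⟩ := ih
    exact ⟨_, h₁.src.src, by rw [C.src_src]; exact h₁.tgt.src⟩
  | tgt_src _ ih =>
    obtain ⟨c, h₁, _⟩ := ih
    exact ⟨_, h₁.src.tgt, by rw [C.tgt_src]; exact h₁.tgt.tgt⟩
  | assoc h _ _ ihl ihr =>
    obtain ⟨l, hl, _⟩ := ihl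
    obtain ⟨r, hr, _⟩ := ihr
    refine ⟨l, hl, ?_⟩
    have hr' := hr
    obtain ⟨_, c, hl₁, ⟨a, b, hab, ha, hb, rfl⟩, hc, rfl⟩ := hl
    obtain ⟨a', _, hr₁, ha', ⟨b', c', hbc, hb', hc', rfl⟩, rfl⟩ := hr
    obtain rfl := ha.unique ha'
    obtain rfl := hb.unique hb'
    obtain rfl := hc.unique hc'
    rw [C.comp_assoc _ _ h a b c hab hbc hl₁ hr₁]
    exact hr'
  | ident_comp h _ ih =>
    obtain ⟨l, hl, _⟩ := ih
    refine ⟨l, hl, ?_⟩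
    obtain ⟨a, c, hac, ha, hc, rfl⟩ := hl
    obtain rfl := ha.unique ((hc.iterDown_src h.le).iterUp h.le)
    rw [C.ident_comp]
    exact hc
  | comp_ident h _ ih =>
    obtain ⟨l, hl, _⟩ := ih
    refine ⟨l, hl, ?_⟩
    obtain ⟨c, a, hac, hc, ha, rfl⟩ := hl
    obtain rfl := ha.unique ((hc.iterDown_tgt h.le).iterUp h.le)
    rw [C.comp_ident]
    exact hc
  | interchange hp hq hpq _ _ ihl ihr =>
    obtain ⟨l, hl, _⟩ := ihl
    obtain ⟨r, hr, _⟩ := ihr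
    refine ⟨l, hl, ?_⟩
    have hr' := hr
    obtain ⟨_, _, hl₁, ⟨a, b, hab, ha, hb, rfl⟩, ⟨c, d, hcd, hc, hd, rfl⟩, rfl⟩ := hl
    obtain ⟨_, _, hr₁, ⟨a', c', hac, ha', hc', rfl⟩, ⟨b', d', hbd, hb', hd', rfl⟩, rfl⟩ := hr
    obtain rfl := ha.unique ha'
    obtain rfl := hb.unique hb'
    obtain rfl := hc.unique hc'
    obtain rfl := hd.unique hd'
    rw [C.interchange _ _ _ hpq hq a b c d hab hcd hl₁ hac hbd hr₁]
    exact hr'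
  | ident_comp_ident h h' _ _ ihl ihr =>
    obtain ⟨l, hl, _⟩ := ihl
    obtain ⟨r, hr, _⟩ := ihr
    refine ⟨l, hl, ?_⟩
    have hr' := hr
    obtain ⟨_, _, hl₁, ⟨a, ha, rfl⟩, ⟨b, hb, rfl⟩, rfl⟩ := hl
    obtain ⟨_, ⟨a', b', hab, ha', hb', rfl⟩, rfl⟩ := hr
    obtain rfl := ha.unique ha'
    obtain rfl := hb.unique hb'
    rw [C.ident_comp_ident _ _ h a b hab hl₁]
    exact hr'

/-- The value of a cell of the free strict `ω`-category under an interpretation. -/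
theorem exists_value (f : A ⟶ C.toGSet) {n : ℕ} (c : Cell A n) :
    ∃ d, ∀ x hx, c = mk x hx → Ev f x d := by
  obtain ⟨x, hx, rfl⟩ := exists_rep c
  obtain ⟨d, hd, _⟩ := hx.ev f
  refine ⟨d, fun y hy e => ?_⟩
  obtain ⟨d', h₁, h₂⟩ := ((mk_eq_iff hx hy).1 e).ev f
  rwa [hd.unique h₁]

/-- The value of a cell of the free strict `ω`-category under an interpretation. -/
noncomputable def value (f : A ⟶ C.toGSet) {n : ℕ} (c : Cell A n) : C.cells n :=
  (exists_value f c).choose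

theorem value_spec (f : A ⟶ C.toGSet) {n : ℕ} (x : Raw A n) (hx : Eqv x x) :
    Ev f x (value f (mk x hx)) := (exists_value f (mk x hx)).choose_spec x hx rfl

theorem value_eq (f : A ⟶ C.toGSet) {n : ℕ} (x : Raw A n) (hx : Eqv x x) {d : C.cells n}
    (h : Ev f x d) : value f (mk x hx) = d := (value_spec f x hx).unique h

/-- The strict `ω`-functor out of the free strict `ω`-category determined by its values on
generators. -/
noncomputable def extend (f : A ⟶ C.toGSet) : free A ⟶ C :=
  StrOmegaCat.Hom.mk
    (GSet.Hom.mk (fun _ c => value f c)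
      (fun n c => by
        obtain ⟨x, hx, rfl⟩ := exists_rep c
        exact value_eq f _ _ (value_spec f x hx).src)
      (fun n c => by
        obtain ⟨x, hx, rfl⟩ := exists_rep c
        exact value_eq f _ _ (value_spec f x hx).tgt))
    (fun _ c => by
      obtain ⟨x, hx, rfl⟩ := exists_rep c
      exact value_eq f _ hx.ident ⟨_, value_spec f x hx, rfl⟩)
    (fun _ k h c d hcd => by
      obtain ⟨x, hx, rfl⟩ := exists_rep c
      obtain ⟨y, hy, rfl⟩ := exists_rep d
      refine (congrArg (value f) (comp_mk h x y hx hy hcd)).trans ?_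
      exact value_eq f _ _ ⟨_, _, _, value_spec f x hx, value_spec f y hy, rfl⟩)

theorem incl_extend (f : A ⟶ C.toGSet) :
    incl A ≫ StrOmegaCat.forget.map (extend f) = f :=
  GSet.hom_ext fun _ a => value_eq f (.of a) (.of a) rfl

theorem Ev.eq_mk {n : ℕ} (x : Raw A n) {c : Cell A n} (h : Ev (C := free A) (incl A) x c) :
    ∃ hx, c = mk x hx := by
  induction x with
  | of a => exact ⟨.of a, h⟩
  | ident x ih =>
    obtain ⟨d, hd, rfl⟩ := h
    obtain ⟨hx, rfl⟩ := ih hd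
    exact ⟨hx.ident, rfl⟩
  | comp k h x y ihx ihy =>
    obtain ⟨a, b, hab, ha, hb, rfl⟩ := h
    obtain ⟨hx, rfl⟩ := ihx ha
    obtain ⟨hy, rfl⟩ := ihy hb
    exact ⟨_, comp_mk h x y hx hy hab⟩

theorem ev_mk {n : ℕ} (x : Raw A n) (hx : Eqv x x) : Ev (C := free A) (incl A) x (mk x hx) := by
  obtain ⟨c, hc, _⟩ := hx.ev (C := free A) (incl A)
  obtain ⟨_, rfl⟩ := hc.eq_mk
  exact hc

theorem Ev.map {D : StrOmegaCat.{u}} (g : C ⟶ D) {f : A ⟶ C.toGSet} {n : ℕ} (x : Raw A n)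
    {c : C.cells n} (h : Ev f x c) :
    Ev (f ≫ StrOmegaCat.forget.map g) x (GSet.Hom.on (StrOmegaCat.Hom.hom g) n c) := by
  induction x with
  | of a => obtain rfl : c = _ := h; rfl
  | ident x ih =>
    obtain ⟨d, hd, rfl⟩ := h
    exact ⟨_, ih hd, StrOmegaCat.Hom.map_ident g _ d⟩
  | comp k h x y ihx ihy =>
    obtain ⟨a, b, hab, ha, hb, rfl⟩ := h
    exact ⟨_, _, _, ihx ha, ihy hb, StrOmegaCat.Hom.map_comp g _ k h a b hab⟩

theorem hom_ext {g g' : free A ⟶ C}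
    (h : incl A ≫ StrOmegaCat.forget.map g = incl A ≫ StrOmegaCat.forget.map g') : g = g' := by
  refine StrOmegaCat.Hom.ext (GSet.hom_ext fun n c => ?_)
  obtain ⟨x, hx, rfl⟩ := exists_rep c
  exact (((ev_mk x hx).map g).congr h).unique ((ev_mk x hx).map g')

/-- The universal property of the free strict `ω`-category. -/
noncomputable def homEquiv (A : GSet.{u}) (C : StrOmegaCat.{u}) :
    (free A ⟶ C) ≃ (A ⟶ StrOmegaCat.forget.obj C) where
  toFun g := incl A ≫ StrOmegaCat.forget.map g
  invFun f := extend f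
  left_inv _ := hom_ext (incl_extend _)
  right_inv f := incl_extend f

end eval

end FreeOmega

/-- The free strict `ω`-category functor. -/
noncomputable def freeOmegaFunctor : GSet.{u} ⥤ StrOmegaCat.{u} :=
  Adjunction.leftAdjointOfEquiv (G := StrOmegaCat.forget) FreeOmega.homEquiv
    (fun _ _ _ _ _ => rfl)

/-- The free strict `ω`-category functor is left adjoint to the forgetful functor. -/
noncomputable def freeOmegaAdj : freeOmegaFunctor.{u} ⊣ StrOmegaCat.forget.{u} :=
  Adjunction.adjunctionOfEquivLeft (G := StrOmegaCat.forget) FreeOmega.homEquiv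
    (fun _ _ _ _ _ => rfl)

/-- The free strict `ω`-category monad `(-)^*` on globular sets. -/
noncomputable def freeOmega : Monad GSet.{u} := freeOmegaAdj.toMonad

/-! ## Globular collections -/

open GSet

/-- The category of globular collections: globular sets over `1^*`. -/
abbrev GColl : Type (u + 1) := Over (freeOmega.{u}.obj one)

namespace GColl

/-- The shape map `!^* : A^* ⟶ 1^*`. -/
noncomputable abbrev shape (A : GSet.{u}) : freeOmega.obj A ⟶ freeOmega.obj one.{u} :=
  freeOmega.map (bang A)

theorem map_shape {A B : GSet.{u}} (f : A ⟶ B) : freeOmega.map f ≫ shape B = shape A := by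
  rw [← Functor.map_comp, to_one_ext (f ≫ bang B) (bang A)]

theorem map_shape_assoc {A B X : GSet.{u}} (f : A ⟶ B) (k : freeOmega.obj one ⟶ X) :
    freeOmega.map f ≫ shape B ≫ k = shape A ≫ k := by
  rw [← Category.assoc, map_shape]

/-- The collection `X ∘ Y`: the pullback of `!^* : X^* ⟶ 1^*` and `Y ⟶ 1^*`, with structure map
`X ∘ Y ⟶ X^* ⟶ 1^** ⟶ 1^*`. -/
noncomputable def circ (X Y : GColl.{u}) : GColl.{u} :=
  Over.mk (Y := pb (shape X.left) Y.hom)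
    (fst (shape X.left) Y.hom ≫ freeOmega.map X.hom ≫ freeOmega.μ.app one)

/-- The first projection `X ∘ Y ⟶ X^*`. -/
noncomputable def circFst (X Y : GColl.{u}) : (circ X Y).left ⟶ freeOmega.obj X.left :=
  fst (shape X.left) Y.hom

/-- The second projection `X ∘ Y ⟶ Y`. -/
noncomputable def circSnd (X Y : GColl.{u}) : (circ X Y).left ⟶ Y.left :=
  snd (shape X.left) Y.hom

theorem circ_hom (X Y : GColl.{u}) :
    (circ X Y).hom = circFst X Y ≫ freeOmega.map X.hom ≫ freeOmega.μ.app one := rfl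

theorem circ_condition (X Y : GColl.{u}) :
    circFst X Y ≫ shape X.left = circSnd X Y ≫ Y.hom := pb_condition _ _

/-- The morphism of globular sets into `X ∘ Y` given by the universal property. -/
noncomputable def circLift {A : GSet.{u}} {X Y : GColl.{u}} (a : A ⟶ freeOmega.obj X.left)
    (b : A ⟶ Y.left) (h : a ≫ shape X.left = b ≫ Y.hom) : A ⟶ (circ X Y).left := lift a b h

section

variable {A B : GSet.{u}} {X Y : GColl.{u}} (a : A ⟶ freeOmega.obj X.left) (b : A ⟶ Y.left)
  (h : a ≫ shape X.left = b ≫ Y.hom)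

@[simp] theorem circLift_fst : circLift a b h ≫ circFst X Y = a := rfl
@[simp] theorem circLift_snd : circLift a b h ≫ circSnd X Y = b := rfl
@[simp] theorem circLift_fst_assoc (k : freeOmega.obj X.left ⟶ B) :
    circLift a b h ≫ circFst X Y ≫ k = a ≫ k := rfl
@[simp] theorem circLift_snd_assoc (k : Y.left ⟶ B) :
    circLift a b h ≫ circSnd X Y ≫ k = b ≫ k := rfl

end

theorem circ_left_ext {A : GSet.{u}} {X Y : GColl.{u}} {p q : A ⟶ (circ X Y).left}
    (h₁ : p ≫ circFst X Y = q ≫ circFst X Y) (h₂ : p ≫ circSnd X Y = q ≫ circSnd X Y) : p = q :=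
  pb_hom_ext h₁ h₂

/-- The action of `∘` on pairs of morphisms. -/
noncomputable def circMap {X X' Y Y' : GColl.{u}} (f : X ⟶ X') (g : Y ⟶ Y') :
    circ X Y ⟶ circ X' Y' :=
  Over.homMk
    (circLift (circFst X Y ≫ freeOmega.map f.left) (circSnd X Y ≫ g.left) (by
      rw [Category.assoc, map_shape, Category.assoc, Over.w, circ_condition]))
    (by
      rw [circ_hom, circLift_fst_assoc, Category.assoc, ← Functor.map_comp_assoc, Over.w, circ_hom])

@[simp] theorem circMap_fst {X X' Y Y' : GColl.{u}} (f : X ⟶ X') (g : Y ⟶ Y') :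
    (circMap f g).left ≫ circFst X' Y' = circFst X Y ≫ freeOmega.map f.left := rfl
@[simp] theorem circMap_snd {X X' Y Y' : GColl.{u}} (f : X ⟶ X') (g : Y ⟶ Y') :
    (circMap f g).left ≫ circSnd X' Y' = circSnd X Y ≫ g.left := rfl

theorem circMap_id_fst (X : GColl.{u}) {Y Y' : GColl.{u}} (g : Y ⟶ Y') :
    (circMap (𝟙 X) g).left ≫ circFst X Y' = circFst X Y :=
  (congrArg (circFst X Y ≫ ·) (freeOmega.map_id X.left)).trans (Category.comp_id _)

/-- The functor `∘ : GColl × GColl ⥤ GColl`. -/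
noncomputable def circFunctor : GColl.{u} × GColl.{u} ⥤ GColl.{u} where
  obj P := circ P.1 P.2
  map p := circMap p.1 p.2
  map_id P := by
    ext1
    apply circ_left_ext
    · rw [circMap_fst]; simp
    · rw [circMap_snd]; simp
  map_comp p q := by
    ext1
    apply circ_left_ext
    · rw [circMap_fst, Over.comp_left, Category.assoc, circMap_fst, ← Category.assoc, circMap_fst]
      simp
    · rw [circMap_snd, Over.comp_left, Category.assoc, circMap_snd, ← Category.assoc, circMap_snd]
      simp

/-- The unit collection `η : 1 ⟶ 1^*`. -/
noncomputable def unit : GColl.{u} := Over.mk (Y := one) (freeOmega.η.app one)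

/-- The canonical comparison `1 ∘ X ⟶ X`. -/
noncomputable def leftUnitor (X : GColl.{u}) : circ unit X ⟶ X :=
  Over.homMk (circSnd unit X) (by
    have h : freeOmega.map (unit : GColl.{u}).hom ≫ freeOmega.μ.app one = 𝟙 _ :=
      freeOmega.right_unit one
    have h' : shape (unit : GColl.{u}).left = 𝟙 _ := by
      rw [← freeOmega.map_id]; exact congrArg _ (to_one_ext _ _)
    rw [circ_hom, h, ← circ_condition, h'])

theorem unit_map_mu {A : GSet.{u}} (a : A ⟶ freeOmega.obj one) :
    freeOmega.η.app A ≫ freeOmega.map a ≫ freeOmega.μ.app one = a :=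
  (Monad.unit_naturality_assoc GSet freeOmega a _).symm.trans
    ((congrArg (a ≫ ·) (freeOmega.left_unit one)).trans (Category.comp_id a))

/-- The canonical comparison `X ⟶ X ∘ 1`. -/
noncomputable def rightUnitorInv (X : GColl.{u}) : X ⟶ circ X unit :=
  Over.homMk
    (circLift (freeOmega.η.app X.left) (bang X.left)
      (freeOmega.η.naturality (bang X.left)).symm)
    (by
      exact unit_map_mu X.hom)

theorem associator_aux₁ (X Y Z : GColl.{u}) :
    (circFst (circ X Y) Z ≫ freeOmega.map (circFst X Y) ≫ freeOmega.μ.app X.left) ≫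
        shape X.left =
      (circFst (circ X Y) Z ≫ freeOmega.map (circSnd X Y)) ≫
        freeOmega.map Y.hom ≫ freeOmega.μ.app one := by
  simp only [Category.assoc]
  rw [← Monad.mu_naturality, ← Functor.map_comp_assoc, circ_condition,
    Functor.map_comp_assoc]

theorem associator_aux₂ (X Y Z : GColl.{u}) :
    (circFst (circ X Y) Z ≫ freeOmega.map (circFst X Y) ≫ freeOmega.μ.app X.left) ≫
        freeOmega.map X.hom ≫ freeOmega.μ.app one =
      circFst (circ X Y) Z ≫
        freeOmega.map (circFst X Y ≫ freeOmega.map X.hom ≫ freeOmega.μ.app one) ≫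
          freeOmega.μ.app one := by
  simp only [Category.assoc, Functor.map_comp]
  rw [← Monad.mu_naturality_assoc, Monad.assoc]

/-- The canonical comparison `(X ∘ Y) ∘ Z ⟶ X ∘ (Y ∘ Z)`. On cells it regards a pasting diagram of
pairs as a pair of pasting diagrams, and flattens the first of them. -/
noncomputable def associator (X Y Z : GColl.{u}) : circ (circ X Y) Z ⟶ circ X (circ Y Z) :=
  Over.homMk
    (circLift
      (circFst (circ X Y) Z ≫ freeOmega.map (circFst X Y) ≫ freeOmega.μ.app X.left)
      (circLift (circFst (circ X Y) Z ≫ freeOmega.map (circSnd X Y)) (circSnd (circ X Y) Z) (by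
        rw [Category.assoc, map_shape, circ_condition]))
      (associator_aux₁ X Y Z))
    (associator_aux₂ X Y Z)

end GColl

/-! ## Globular operads -/

open GColl

/-- A globular operad: a monoid in the category of globular collections with tensor product `∘`
and unit `η : 1 ⟶ 1^*`. The unit and associativity laws are written with the canonical comparisons
`1 ∘ X ⟶ X`, `X ⟶ X ∘ 1` and `(X ∘ Y) ∘ Z ⟶ X ∘ (Y ∘ Z)`, which are the coherence isomorphisms of
this monoidal structure. -/
structure GlobularOperad : Type (u + 1) where
  coll : GColl.{u}
  ids : unit ⟶ coll
  comp : circ coll coll ⟶ coll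
  id_comp : circMap ids (𝟙 coll) ≫ comp = leftUnitor coll
  comp_id : rightUnitorInv coll ≫ circMap (𝟙 coll) ids ≫ comp = 𝟙 coll
  assoc : circMap comp (𝟙 coll) ≫ comp =
    associator coll coll coll ≫ circMap (𝟙 coll) comp ≫ comp

namespace GlobularOperad

/-- A morphism of globular operads: a morphism of collections preserving identities and
composition. -/
@[ext]
structure Hom (G H : GlobularOperad.{u}) : Type u where
  hom : G.coll ⟶ H.coll
  ids_hom : G.ids ≫ hom = H.ids
  comp_hom : G.comp ≫ hom = circMap hom hom ≫ H.comp

noncomputable instance : Category GlobularOperad.{u} where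
  Hom := Hom
  id G := ⟨𝟙 _, Category.comp_id _, by
    rw [Category.comp_id]
    exact ((congrArg (· ≫ G.comp) (circFunctor.map_id (G.coll, G.coll))).trans
      (Category.id_comp _)).symm⟩
  comp {G H K} f g := ⟨f.hom ≫ g.hom, by rw [← Category.assoc, f.ids_hom, g.ids_hom], by
    rw [← Category.assoc, f.comp_hom, Category.assoc, g.comp_hom, ← Category.assoc]
    exact congrArg (· ≫ K.comp) (circFunctor.map_comp
      (X := (G.coll, G.coll)) (Y := (H.coll, H.coll)) (Z := (K.coll, K.coll))
      (f.hom, f.hom) (g.hom, g.hom)).symm⟩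

end GlobularOperad

/-! ## Algebras -/

namespace GColl

/-- The globular set `A_X`: the pullback of `!^* : A^* ⟶ 1^*` and `X ⟶ 1^*`. -/
noncomputable def act (X : GColl.{u}) (A : GSet.{u}) : GSet.{u} := pb (shape A) X.hom

/-- The projection `A_X ⟶ A^*`. -/
noncomputable def actFst (X : GColl.{u}) (A : GSet.{u}) : act X A ⟶ freeOmega.obj A :=
  fst (shape A) X.hom

/-- The projection `A_X ⟶ X`. -/
noncomputable def actSnd (X : GColl.{u}) (A : GSet.{u}) : act X A ⟶ X.left :=
  snd (shape A) X.hom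

theorem act_condition (X : GColl.{u}) (A : GSet.{u}) :
    actFst X A ≫ shape A = actSnd X A ≫ X.hom := pb_condition _ _

/-- The morphism into `A_X` given by the universal property. -/
noncomputable def actLift {B : GSet.{u}} {X : GColl.{u}} {A : GSet.{u}} (a : B ⟶ freeOmega.obj A)
    (b : B ⟶ X.left) (h : a ≫ shape A = b ≫ X.hom) : B ⟶ act X A := lift a b h

section

variable {B D : GSet.{u}} {X : GColl.{u}} {A : GSet.{u}} (a : B ⟶ freeOmega.obj A)
  (b : B ⟶ X.left) (h : a ≫ shape A = b ≫ X.hom)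

@[simp] theorem actLift_fst : actLift a b h ≫ actFst X A = a := rfl
@[simp] theorem actLift_snd : actLift a b h ≫ actSnd X A = b := rfl
@[simp] theorem actLift_fst_assoc (k : freeOmega.obj A ⟶ D) :
    actLift a b h ≫ actFst X A ≫ k = a ≫ k := rfl
@[simp] theorem actLift_snd_assoc (k : X.left ⟶ D) :
    actLift a b h ≫ actSnd X A ≫ k = b ≫ k := rfl

end

theorem act_ext {B : GSet.{u}} {X : GColl.{u}} {A : GSet.{u}} {p q : B ⟶ act X A}
    (h₁ : p ≫ actFst X A = q ≫ actFst X A) (h₂ : p ≫ actSnd X A = q ≫ actSnd X A) : p = q :=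
  pb_hom_ext h₁ h₂

/-- The action of `A ↦ A_X` on morphisms. -/
noncomputable def actMap (X : GColl.{u}) {A B : GSet.{u}} (φ : A ⟶ B) : act X A ⟶ act X B :=
  actLift (actFst X A ≫ freeOmega.map φ) (actSnd X A) (by
    rw [Category.assoc, map_shape, act_condition])

@[simp] theorem actMap_fst (X : GColl.{u}) {A B : GSet.{u}} (φ : A ⟶ B) :
    actMap X φ ≫ actFst X B = actFst X A ≫ freeOmega.map φ := rfl
@[simp] theorem actMap_snd (X : GColl.{u}) {A B : GSet.{u}} (φ : A ⟶ B) :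
    actMap X φ ≫ actSnd X B = actSnd X A := rfl
@[simp] theorem actMap_fst_assoc (X : GColl.{u}) {A B D : GSet.{u}} (φ : A ⟶ B)
    (k : freeOmega.obj B ⟶ D) :
    actMap X φ ≫ actFst X B ≫ k = actFst X A ≫ freeOmega.map φ ≫ k := rfl
@[simp] theorem actMap_snd_assoc (X : GColl.{u}) {A B D : GSet.{u}} (φ : A ⟶ B)
    (k : X.left ⟶ D) : actMap X φ ≫ actSnd X B ≫ k = actSnd X A ≫ k := rfl

/-- The functor `A ↦ A_X`. -/
noncomputable def actFunctor (X : GColl.{u}) : GSet.{u} ⥤ GSet.{u} where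
  obj A := act X A
  map φ := actMap X φ
  map_id A := act_ext (by simp) (by simp)
  map_comp φ ψ := act_ext (by simp) (by simp)

/-- For a morphism `f : X ⟶ Y` of collections, `A_f : A_X ⟶ A_Y` is the morphism induced by the
universal property of the pullback `A_Y` from `A_X ⟶ A^*` and `A_X ⟶ X ⟶ Y`. -/
noncomputable def actHom {X Y : GColl.{u}} (f : X ⟶ Y) (A : GSet.{u}) : act X A ⟶ act Y A :=
  actLift (actFst X A) (actSnd X A ≫ f.left) (by rw [Category.assoc, Over.w, act_condition])

theorem actHom_unique {X Y : GColl.{u}} (f : X ⟶ Y) (A : GSet.{u}) :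
    (actHom f A ≫ actFst Y A = actFst X A ∧ actHom f A ≫ actSnd Y A = actSnd X A ≫ f.left) ∧
      ∀ k : act X A ⟶ act Y A, k ≫ actFst Y A = actFst X A →
        k ≫ actSnd Y A = actSnd X A ≫ f.left → k = actHom f A :=
  ⟨⟨rfl, rfl⟩, fun _ h₁ h₂ => act_ext h₁ h₂⟩

/-- The canonical morphism `(A_X)_X ⟶ X ∘ X`. -/
noncomputable def actCirc (X : GColl.{u}) (A : GSet.{u}) : act X (act X A) ⟶ (circ X X).left :=
  circLift (actFst X (act X A) ≫ freeOmega.map (actSnd X A)) (actSnd X (act X A)) (by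
    rw [Category.assoc, map_shape, act_condition])

@[simp] theorem actCirc_fst (X : GColl.{u}) (A : GSet.{u}) :
    actCirc X A ≫ circFst X X = actFst X (act X A) ≫ freeOmega.map (actSnd X A) := rfl
@[simp] theorem actCirc_snd (X : GColl.{u}) (A : GSet.{u}) :
    actCirc X A ≫ circSnd X X = actSnd X (act X A) := rfl
@[simp] theorem actCirc_fst_assoc (X : GColl.{u}) {A D : GSet.{u}}
    (k : freeOmega.obj X.left ⟶ D) :
    actCirc X A ≫ circFst X X ≫ k = actFst X (act X A) ≫ freeOmega.map (actSnd X A) ≫ k := rfl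

theorem unit_mu (A : GSet.{u}) :
    freeOmega.η.app (freeOmega.obj A) ≫ freeOmega.μ.app A = 𝟙 (freeOmega.obj A) :=
  freeOmega.left_unit A

theorem map_unit_mu (A : GSet.{u}) :
    freeOmega.map (freeOmega.η.app A) ≫ freeOmega.μ.app A = 𝟙 (freeOmega.obj A) :=
  freeOmega.right_unit A

theorem unit_naturality {A B : GSet.{u}} (φ : A ⟶ B) :
    freeOmega.η.app A ≫ freeOmega.map φ = φ ≫ freeOmega.η.app B :=
  (Monad.unit_naturality GSet freeOmega φ).symm

theorem unit_naturality_assoc {A B D : GSet.{u}} (φ : A ⟶ B) (k : freeOmega.obj B ⟶ D) :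
    freeOmega.η.app A ≫ freeOmega.map φ ≫ k = φ ≫ freeOmega.η.app B ≫ k :=
  (Monad.unit_naturality_assoc GSet freeOmega φ k).symm

end GColl

namespace GlobularOperad

variable (G : GlobularOperad.{u})

/-- The underlying morphism `1 ⟶ G` of the identity map. -/
noncomputable def idsMap : one ⟶ G.coll.left := G.ids.left

theorem idsMap_hom : G.idsMap ≫ G.coll.hom = freeOmega.η.app one := Over.w G.ids

/-- The unit `A ⟶ A_G`. -/
noncomputable def unitApp (A : GSet.{u}) : A ⟶ act G.coll A :=
  actLift (freeOmega.η.app A) (bang A ≫ G.idsMap) (by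
    rw [Category.assoc, idsMap_hom, GColl.unit_naturality])

@[simp] theorem unitApp_fst (A : GSet.{u}) :
    G.unitApp A ≫ actFst G.coll A = freeOmega.η.app A := rfl
@[simp] theorem unitApp_snd (A : GSet.{u}) :
    G.unitApp A ≫ actSnd G.coll A = bang A ≫ G.idsMap := rfl
@[simp] theorem unitApp_fst_assoc {A D : GSet.{u}} (k : freeOmega.obj A ⟶ D) :
    G.unitApp A ≫ actFst G.coll A ≫ k = freeOmega.η.app A ≫ k := rfl

theorem multApp_aux (A : GSet.{u}) :
    (actFst G.coll (act G.coll A) ≫ freeOmega.map (actFst G.coll A) ≫ freeOmega.μ.app A) ≫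
      shape A = (actCirc G.coll A ≫ G.comp.left) ≫ G.coll.hom := by
  rw [Category.assoc _ G.comp.left, Over.w, circ_hom, actCirc, circLift_fst_assoc]
  simp only [Category.assoc]
  rw [← Functor.map_comp_assoc, ← act_condition, Functor.map_comp_assoc, ← Monad.mu_naturality]

/-- The multiplication `(A_G)_G ⟶ A_G`. -/
noncomputable def multApp (A : GSet.{u}) : act G.coll (act G.coll A) ⟶ act G.coll A :=
  actLift
    (actFst G.coll (act G.coll A) ≫ freeOmega.map (actFst G.coll A) ≫ freeOmega.μ.app A)
    (actCirc G.coll A ≫ G.comp.left) (G.multApp_aux A)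

@[simp] theorem multApp_fst (A : GSet.{u}) : G.multApp A ≫ actFst G.coll A =
    actFst G.coll (act G.coll A) ≫ freeOmega.map (actFst G.coll A) ≫ freeOmega.μ.app A := rfl
@[simp] theorem multApp_snd (A : GSet.{u}) : G.multApp A ≫ actSnd G.coll A =
    actCirc G.coll A ≫ G.comp.left := rfl
@[simp] theorem multApp_fst_assoc {A D : GSet.{u}} (k : freeOmega.obj A ⟶ D) :
    G.multApp A ≫ actFst G.coll A ≫ k = actFst G.coll (act G.coll A) ≫
      freeOmega.map (actFst G.coll A) ≫ freeOmega.μ.app A ≫ k := rfl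

theorem id_comp_left : (circMap G.ids (𝟙 G.coll)).left ≫ G.comp.left = circSnd unit G.coll :=
  congrArg CommaMorphism.left G.id_comp

theorem comp_id_left : (rightUnitorInv G.coll).left ≫ (circMap (𝟙 G.coll) G.ids).left ≫
    G.comp.left = 𝟙 G.coll.left :=
  congrArg CommaMorphism.left G.comp_id

theorem assoc_left : (circMap G.comp (𝟙 G.coll)).left ≫ G.comp.left =
    (associator G.coll G.coll G.coll).left ≫ (circMap (𝟙 G.coll) G.comp).left ≫ G.comp.left :=
  congrArg CommaMorphism.left G.assoc

theorem multApp_naturality {A B : GSet.{u}} (φ : A ⟶ B) :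
    actMap G.coll (actMap G.coll φ) ≫ G.multApp B = G.multApp A ≫ actMap G.coll φ := by
  apply act_ext
  · simp only [Category.assoc, multApp_fst, actMap_fst, actMap_fst_assoc, multApp_fst_assoc]
    rw [← Functor.map_comp_assoc, actMap_fst, Functor.map_comp_assoc, ← Monad.mu_naturality]
  · have h : actMap G.coll (actMap G.coll φ) ≫ actCirc G.coll B = actCirc G.coll A := by
      apply circ_left_ext
      · simp only [Category.assoc, actCirc_fst, actMap_fst_assoc, ← Functor.map_comp, actMap_snd]
      · rfl
    simp only [Category.assoc, multApp_snd, actMap_snd]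
    rw [← Category.assoc, h]

theorem monad_left_unit (A : GSet.{u}) :
    G.unitApp (act G.coll A) ≫ G.multApp A = 𝟙 (act G.coll A) := by
  apply act_ext
  · simp only [Category.assoc, multApp_fst, unitApp_fst_assoc, Category.id_comp]
    rw [unit_naturality_assoc, unit_mu, Category.comp_id]
  · have h : G.unitApp (act G.coll A) ≫ actCirc G.coll A =
        actSnd G.coll A ≫ (rightUnitorInv G.coll).left ≫ (circMap (𝟙 G.coll) G.ids).left := by
      apply circ_left_ext
      · simp only [Category.assoc, actCirc_fst, unitApp_fst_assoc, circMap_id_fst]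
        exact unit_naturality _
      · rfl
    rw [Category.assoc, multApp_snd, ← Category.assoc, h]
    simp only [Category.assoc, Category.id_comp]
    rw [comp_id_left, Category.comp_id]

theorem monad_right_unit (A : GSet.{u}) :
    actMap G.coll (G.unitApp A) ≫ G.multApp A = 𝟙 (act G.coll A) := by
  apply act_ext
  · simp only [Category.assoc, multApp_fst, actMap_fst_assoc, Category.id_comp]
    rw [← Functor.map_comp_assoc, unitApp_fst, map_unit_mu, Category.comp_id]
  · have h : actMap G.coll (G.unitApp A) ≫ actCirc G.coll A =
        circLift (X := unit) (actFst G.coll A ≫ shape A) (actSnd G.coll A) (by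
          have h' : shape (unit : GColl.{u}).left = 𝟙 _ := by
            rw [← freeOmega.map_id]; exact congrArg _ (to_one_ext _ _)
          rw [h', ← act_condition]; exact Category.comp_id _) ≫
        (circMap G.ids (𝟙 G.coll)).left := by
      apply circ_left_ext
      · simp only [Category.assoc, actCirc_fst, actMap_fst_assoc, circMap_fst,
          circLift_fst_assoc]
        rw [← Functor.map_comp, unitApp_snd, Functor.map_comp]
        rfl
      · rfl
    rw [Category.assoc, multApp_snd, ← Category.assoc, h, Category.assoc, id_comp_left,
      circLift_snd, Category.id_comp]

/-- The canonical morphism `((A_G)_G)_G ⟶ (G ∘ G) ∘ G`. -/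
noncomputable def actCircCirc (A : GSet.{u}) :
    act G.coll (act G.coll (act G.coll A)) ⟶ (circ (circ G.coll G.coll) G.coll).left :=
  circLift (X := circ G.coll G.coll)
    (actFst G.coll (act G.coll (act G.coll A)) ≫ freeOmega.map (actCirc G.coll A))
    (actSnd G.coll (act G.coll (act G.coll A)))
    (by rw [Category.assoc, map_shape, act_condition])

theorem monad_assoc_aux₁ (A : GSet.{u}) :
    actMap G.coll (G.multApp A) ≫ actCirc G.coll A =
      G.actCircCirc A ≫ (circMap G.comp (𝟙 G.coll)).left := by
  apply circ_left_ext
  · simp only [Category.assoc, actCirc_fst, actMap_fst_assoc, circMap_fst]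
    rw [actCircCirc, circLift_fst_assoc, Category.assoc, ← Functor.map_comp, ← Functor.map_comp,
      multApp_snd]
  · rfl

theorem monad_assoc_aux₂ (A : GSet.{u}) :
    actCirc G.coll (act G.coll A) =
      G.actCircCirc A ≫ (associator G.coll G.coll G.coll).left ≫ circSnd _ _ := by
  apply circ_left_ext
  · change actFst G.coll _ ≫ freeOmega.map (actSnd G.coll _) =
      (actFst G.coll _ ≫ freeOmega.map (actCirc G.coll A)) ≫
        freeOmega.map (circSnd G.coll G.coll)
    rw [Category.assoc, ← Functor.map_comp, actCirc_snd]
  · rfl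

theorem monad_assoc_aux₃ (A : GSet.{u}) :
    G.multApp (act G.coll A) ≫ actCirc G.coll A =
      G.actCircCirc A ≫ (associator G.coll G.coll G.coll).left ≫
        (circMap (𝟙 G.coll) G.comp).left := by
  apply circ_left_ext
  · simp only [Category.assoc, actCirc_fst, multApp_fst_assoc, circMap_id_fst]
    rw [← Monad.mu_naturality, ← Functor.map_comp_assoc]
    change _ = (actFst G.coll _ ≫ freeOmega.map (actCirc G.coll A)) ≫
      freeOmega.map (circFst G.coll G.coll) ≫ freeOmega.μ.app G.coll.left
    rw [Category.assoc, ← Functor.map_comp_assoc, actCirc_fst]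
  · simp only [Category.assoc, actCirc_snd, multApp_snd, circMap_snd]
    rw [monad_assoc_aux₂]
    simp only [Category.assoc]

theorem monad_assoc (A : GSet.{u}) :
    actMap G.coll (G.multApp A) ≫ G.multApp A = G.multApp (act G.coll A) ≫ G.multApp A := by
  apply act_ext
  · simp only [Category.assoc, multApp_fst, multApp_fst_assoc, actMap_fst_assoc]
    rw [← Functor.map_comp_assoc, multApp_fst]
    simp only [Functor.map_comp, Category.assoc]
    rw [Monad.assoc, ← Monad.mu_naturality_assoc]
  · rw [Category.assoc, Category.assoc, multApp_snd, ← Category.assoc, ← Category.assoc,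
      monad_assoc_aux₁, monad_assoc_aux₃]
    simp only [Category.assoc]
    rw [assoc_left]

/-- The monad `A ↦ A_G` on globular sets induced by a globular operad. -/
noncomputable def monad : Monad GSet.{u} where
  toFunctor := actFunctor G.coll
  η :=
    { app := fun A => G.unitApp A
      naturality := fun _ _ φ => act_ext (GColl.unit_naturality φ).symm rfl }
  μ :=
    { app := fun A => G.multApp A
      naturality := fun _ _ φ => G.multApp_naturality φ }
  left_unit := G.monad_left_unit
  right_unit := G.monad_right_unit
  assoc := G.monad_assoc

/-- The category of algebras for a globular operad. -/
abbrev Alg : Type (u + 1) := G.monad.Algebra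

end GlobularOperad

/-! ### Naturality of `A_f` in the globular set and in the collection. -/

namespace GColl

/-! The maps `A_f` form a morphism of monads from `(-)_G` to `(-)_H`, and algebras pull back
contravariantly along a morphism of monads. Indeed, write `θ` for the action of an `H`-algebra.
Compatibility of `A_f` with units turns the unit law for `θ` into the unit law for `θ · A_f`.
Compatibility with multiplications, the associativity of `θ` and the naturality square of `A_f` at
`θ` together give the associativity of `θ · A_f`. Naturality at an arbitrary morphism of algebras
shows that it still commutes with the new actions. Underlying morphisms do not change, so the
resulting functor is faithful.

What has to be proved is therefore naturality (`actHom_naturality`), compatibility with units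
(`unitApp_actHom`) and compatibility with multiplications (`multApp_actHom`). Each is an equation
between maps into a pullback, tested on the two projections. On the pasting-diagram coordinate `A^*`
the operads play no role: `A_f` lies over `A^*`, and the unit and multiplication of both monads act
there through `η` and `μ` of `(-)^*`. On the operad coordinate the unit equation is preservation of
identities by `f`. The multiplication equation is preservation of composition, transported along the
comparison of `(A_G)_G` with `G ∘ G` by means of `actCirc_naturality`. -/

@[simp] theorem actHom_fst {X Y : GColl.{u}} (f : X ⟶ Y) (A : GSet.{u}) :
    actHom f A ≫ actFst Y A = actFst X A := rfl

@[simp] theorem actHom_snd {X Y : GColl.{u}} (f : X ⟶ Y) (A : GSet.{u}) :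
    actHom f A ≫ actSnd Y A = actSnd X A ≫ f.left := rfl

theorem actHom_fst_assoc {X Y : GColl.{u}} (f : X ⟶ Y) {A D : GSet.{u}}
    (k : freeOmega.obj A ⟶ D) : actHom f A ≫ actFst Y A ≫ k = actFst X A ≫ k := rfl

/-- A cell of `A_X` is a pasting diagram in `A` paired with a cell of `X` of the same shape. The map
`φ` touches only the first entry and `f` only the second, so the two operations commute; since
pullbacks consist of actual pairs, both projections agree by definition. -/
theorem actHom_naturality {X Y : GColl.{u}} (f : X ⟶ Y) {A B : GSet.{u}} (φ : A ⟶ B) :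
    actMap X φ ≫ actHom f B = actHom f A ≫ actMap Y φ :=
  act_ext rfl rfl

/-- The comparison `(A_X)_X ⟶ X ∘ X` is natural in the collection `X`. -/
theorem actCirc_naturality {X Y : GColl.{u}} (f : X ⟶ Y) (A : GSet.{u}) :
    (actMap X (actHom f A) ≫ actHom f (act Y A)) ≫ actCirc Y A =
      actCirc X A ≫ (circMap f f).left := by
  apply circ_left_ext
  -- The first coordinate is the pasting diagram of inner labels, so the inner `A_f` appears under
  -- `(-)^*`. Fusing it with the image of the second projection by functoriality lets `actHom_snd`
  -- act there, and both sides become the image under `(-)^*` of projecting to `X` and then applying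
  -- `f`.
  · simp only [Category.assoc, actCirc_fst, actHom_fst_assoc, actMap_fst_assoc, circMap_fst,
      actCirc_fst_assoc, ← Functor.map_comp, actHom_snd]
  -- The second coordinate is the outer label, which is changed by the outer `f` alone.
  · rfl

end GColl

/-! ### Compatibility of `A_f` with the units and multiplications of the two monads. -/

namespace GlobularOperad

variable {G H : GlobularOperad.{u}} (f : Hom G H)

/-- On `A^*` both sides are the unit `η`. On the operad coordinate both label a cell with the
identity of its dimension, and `f` carries the identities of `G` to those of `H`. -/
theorem unitApp_actHom (A : GSet.{u}) : G.unitApp A ≫ actHom f.hom A = H.unitApp A := by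
  apply act_ext
  · rfl
  -- The operad axiom lives in the slice over `1^*`; taking `left` gives the equation of globular
  -- sets needed here.
  · have h : G.idsMap ≫ f.hom.left = H.idsMap := congrArg CommaMorphism.left f.ids_hom
    rw [Category.assoc, actHom_snd, ← Category.assoc, unitApp_snd, Category.assoc, h, unitApp_snd]

/-- Composing labels in `G` and then applying `f` agrees with applying `f` to both layers of labels
and composing in `H`. The two layers are relabelled inner first, then outer; by naturality the other
order gives the same map, and this one matches the multiplication law for morphisms of monads. -/
theorem multApp_actHom (A : GSet.{u}) : G.multApp A ≫ actHom f.hom A =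
    (actMap G.coll (actHom f.hom A) ≫ actHom f.hom (act H.coll A)) ≫ H.multApp A := by
  apply act_ext
  · simp only [Category.assoc, actHom_fst, multApp_fst, actHom_fst_assoc, actMap_fst_assoc]
    -- Both sides flatten a pasting diagram of pasting diagrams with `μ`. The inner relabelling on
    -- the right disappears because `A_f` commutes with the projections to `A^*`.
    rw [← Functor.map_comp_assoc, actHom_fst]
  · have h : G.comp.left ≫ f.hom.left = (circMap f.hom f.hom).left ≫ H.comp.left :=
      congrArg CommaMorphism.left f.comp_hom
    -- Preservation of composition moves `f` past `G.comp` on the left, producing `f ∘ f` followed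
    -- by `H.comp`. On the right, `actCirc_naturality` pulls the two relabellings through the
    -- comparison map and yields the same `f ∘ f`.
    rw [Category.assoc, actHom_snd, ← Category.assoc, multApp_snd, Category.assoc, h,
      Category.assoc _ (H.multApp A), multApp_snd, ← Category.assoc _ (actCirc H.coll A),
      actCirc_naturality, Category.assoc]

/-- The morphism of monads `A_f : A_G ⟶ A_H` induced by a morphism of globular operads. -/
noncomputable def monadHom : G.monad ⟶ H.monad where
  app A := actHom f.hom A
  naturality _ _ φ := actHom_naturality f.hom φ
  app_η A := unitApp_actHom f A
  app_μ A := multApp_actHom f A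

end GlobularOperad

/-! ### Restriction of algebras along `f`. -/

/-- The strict equality of forgetful functors expresses that underlying morphisms are kept. The
existential over `hunit` and `hassoc` carries the claim that `θ · A_f` satisfies the algebra laws.
-/
theorem mainTheorem6 {G H : GlobularOperad.{u}} (f : G ⟶ H) :
    ∃ F : H.Alg ⥤ G.Alg, F.Faithful ∧
      F ⋙ G.monad.forget = H.monad.forget ∧
      ∀ X : H.Alg, ∃ hunit hassoc,
        F.obj X =
          { A := X.A
            a := GColl.actHom (GlobularOperad.Hom.hom f) X.A ≫ X.a
            unit := hunit
            assoc := hassoc } := by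
  -- Precomposing the action with the components of a morphism of monads reverses direction:
  -- `G.monad ⟶ H.monad` induces a functor from `H`-algebras to `G`-algebras.
  let F := Monad.algebraFunctorOfMonadHom (GlobularOperad.monadHom f)
  -- A morphism of algebras is determined by its underlying map, and `F` leaves that map as it is.
  have hF : F.Faithful := ⟨fun h => by
    have h' := congrArg Monad.Algebra.Hom.f h
    exact Monad.Algebra.Hom.ext h'⟩
  -- The proofs of the two laws are read off from `F.obj X`, whose carrier and action are by
  -- definition the prescribed ones.
  exact ⟨F, hF, rfl, fun X => ⟨(F.obj X).unit, (F.obj X).assoc, rfl⟩⟩
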